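/- Let $N\ge 1$ be an integer and $\alpha>0$. For $t>0$ and measurable $f:\mathbb R^N\to[0,\infty]$ put $$({\rm e}^{t\Delta}f)(x)=(4\pi t)^{-N/2}\int_{\mathbb R^N}e^{-|x-y|^2/(4t)}f(y)\,dy\in[0,\infty].$$ For a measurable $u_0:\mathbb R^N\to[0,\infty)$ and $T>0$, a nonnegative solution on $(0,T)$ of the nonlinear heat equation $\partial_tu=\Delta u+|u|^\alpha u$ with initial value $u_0$ is a measurable function $u:(0,T)\times\mathbb R^N\to[0,\infty)$ such that $$u(t,x)=({\rm e}^{t\Delta}u_0)(x)+\int_0^t\big({\rm e}^{(t-\sigma)\Delta}\big[|u(\sigma)|^\alpha u(\sigma)\big]\big)(x)\,d\sigma\quad\text{for almost every }(t,x)\in(0,T)\times\mathbb R^N.$$ Let $T_{\max}(u_0)\in[0,\infty]$ be the supremum of all $T>0$ for which such a solution exists ($T_{\max}(u_0)=0$ if there is none). **Theorem 1.5.** Let $0<\gamma<N$ and $\gamma<\frac2\alpha$. Let $\omega\in L^\infty(\mathbb R^N)$ be homogeneous of degree $0$, $\omega\ge0$ and $\omega\not\equiv0$. Suppose that $\varphi\in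 L^1_{\rm loc}(\mathbb R^N)$, $\varphi\ge0$, and that for some $\epsilon>0$, $\varphi(x)\ge\omega(x)|x|^{-\gamma}$ for $|x|\le\epsilon$. (Relations between elements of $L^\infty$ and $L^1_{\rm loc}$ are understood almost everywhere.) Then $T_{\max}(\lambda\varphi)<\infty$ for all sufficiently large $\lambda>0$, and $$\limsup_{\lambda\to\infty}\lambda^{\left(\frac1\alpha-\frac\gamma2\right)^{-1}}T_{\max}(\lambda\varphi)\le\frac1{\left(\alpha^{1/\alpha}\,\big\|{\rm e}^{\Delta}(\omega|\cdot|^{-\gamma})\big\|_\infty\right)^{\left(\frac1\alpha-\frac\gamma2\right)^{-1}}}.$$ -/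

import Mathlib

open MeasureTheory Filter Set
open scoped ENNReal

noncomputable section

namespace NonlinearHeat

/-- The Gauss kernel `(4 π t)^(-N/2) exp (-|x|² / (4 t))` on `ℝ^N`, for `t > 0`. -/
def gaussKernel (N : ℕ) (t : ℝ) (x : EuclideanSpace ℝ (Fin N)) : ℝ :=
  (4 * Real.pi * t) ^ (-(N : ℝ) / 2) * Real.exp (-‖x‖ ^ 2 / (4 * t))

/-- The heat semigroup `e^{tΔ}` on `ℝ^N` (`t > 0`) acting on nonnegative functions, by convolution
with the Gauss kernel. The value `∞` is allowed and means that the integral diverges. -/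
def heat {N : ℕ} (t : ℝ) (f : EuclideanSpace ℝ (Fin N) → ℝ≥0∞)
    (x : EuclideanSpace ℝ (Fin N)) : ℝ≥0∞ :=
  ∫⁻ y, ENNReal.ofReal (gaussKernel N t (x - y)) * f y

/-- `u` is a nonnegative solution on `(0,T) × ℝ^N`, with initial value `u₀ ≥ 0`, of the integral
equation `u(t) = e^{tΔ} u₀ + ∫₀ᵗ e^{(t-σ)Δ} [|u(σ)|^α u(σ)] dσ`. The function `u` is measurable and
finite, and the equation holds at almost every `(t,x)` of `(0,T) × ℝ^N`. All terms are
nonnegative, so the right-hand side is meaningful in `[0,∞]`, and the equation forces it to be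
finite almost everywhere. -/
structure IsNonnegSolution {N : ℕ} (α : ℝ) (u₀ : EuclideanSpace ℝ (Fin N) → ℝ) (T : ℝ)
    (u : ℝ → EuclideanSpace ℝ (Fin N) → ℝ) : Prop where
  measurable : Measurable (Function.uncurry u)
  nonneg : ∀ t x, 0 ≤ u t x
  eqn : ∀ᵐ p : ℝ × EuclideanSpace ℝ (Fin N), p.1 ∈ Ioo 0 T →
    ENNReal.ofReal (u p.1 p.2) =
      heat p.1 (fun y => ENNReal.ofReal (u₀ y)) p.2 +
        ∫⁻ σ in Ioo 0 p.1, heat (p.1 - σ) (fun y => ENNReal.ofReal (|u σ y| ^ α * u σ y)) p.2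

/-- The maximal existence time in `[0,∞]` of a nonnegative solution with initial value `u₀ ≥ 0`:
the supremum of all `T > 0` such that there is a nonnegative solution on `(0,T) × ℝ^N`.
It is `0` if there is no local nonnegative solution. -/
def Tmax {N : ℕ} (α : ℝ) (u₀ : EuclideanSpace ℝ (Fin N) → ℝ) : ℝ≥0∞ :=
  ⨆ (T : ℝ) (_ : 0 < T ∧ ∃ u, IsNonnegSolution α u₀ T u), ENNReal.ofReal T

end NonlinearHeat

end

/-! Fix a solution `u` and a point `(t, x)` where the equation holds, and put h(s) = (e^{(t-s)Δ}
u(s))(x). The semigroup law turns Duhamel's formula into h(s) = g + ∫₀ˢ H for a.e. s, with g =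
(e^{tΔ} u₀)(x) and H(σ) = (e^{(t-σ)Δ} u(σ)^{1+α})(x). Jensen gives H ≥ h^{1+α}, and comparison with
the ODE y' = y^{1+α} forces α t g^α ≤ 1 (`IsNonnegSolution.ofReal_mul_heat_rpow_le_one`). For data
λφ, the self-similarity of ω|x|^{-γ} bounds g at the point √t x below by λ t^{-γ/2} (e^Δ of the
profile cut off at radius ε/√t)(x). Large λ forces t to be small, so the cutoff disappears in the
limit. This gives λ α^{1/α} M t^{1/α-γ/2} ≤ 1 for each M below the sup norm
(`IsNonnegSolution.mul_rpow_le_one`, `eventually_Tmax_le`). -/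

namespace NonlinearHeat

variable {N : ℕ}

/-! ### Gauss kernel and heat semigroup. -/

lemma gaussKernel_pos {t : ℝ} (ht : 0 < t) (x : EuclideanSpace ℝ (Fin N)) :
    0 < gaussKernel N t x := by
  unfold gaussKernel
  positivity

lemma measurable_gaussKernel :
    Measurable fun p : ℝ × EuclideanSpace ℝ (Fin N) => gaussKernel N p.1 p.2 := by
  unfold gaussKernel
  fun_prop

lemma lintegral_gaussKernel {t : ℝ} (ht : 0 < t) :
    ∫⁻ x, ENNReal.ofReal (gaussKernel N t x) = 1 := by
  have hb : 0 < 1 / (4 * t) := by positivity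
  have h := GaussianFourier.integral_rexp_neg_mul_sq_norm (V := EuclideanSpace ℝ (Fin N)) hb
  have hint : Integrable fun v : EuclideanSpace ℝ (Fin N) =>
      Real.exp (-(1 / (4 * t)) * ‖v‖ ^ 2) := by
    by_contra hc
    rw [integral_undef hc] at h
    have : 0 < (Real.pi / (1 / (4 * t))) ^
      ((Module.finrank ℝ (EuclideanSpace ℝ (Fin N)) : ℝ) / 2) := by positivity
    exact this.ne h
  have hg : ∀ x : EuclideanSpace ℝ (Fin N), gaussKernel N t x =
      (4 * Real.pi * t) ^ (-(N : ℝ) / 2) * Real.exp (-(1 / (4 * t)) * ‖x‖ ^ 2) := by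
    intro x
    unfold gaussKernel
    congr 2
    field_simp
  simp_rw [hg]
  rw [← ofReal_integral_eq_lintegral_ofReal (hint.const_mul _)
    (ae_of_all _ fun x => by positivity), integral_const_mul, h, finrank_euclideanSpace_fin,
    show Real.pi / (1 / (4 * t)) = 4 * Real.pi * t by field_simp,
    ← Real.rpow_add (by positivity)]
  simp [neg_div]

/-- Completing the square in z: the product is a Gaussian centred at a weighted mean of x and y, so
integrating over z leaves only the first factor. -/
lemma gaussKernel_mul_gaussKernel {s t : ℝ} (hs : 0 < s) (ht : 0 < t)
    (x y z : EuclideanSpace ℝ (Fin N)) :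
    gaussKernel N s (x - z) * gaussKernel N t (z - y) =
      gaussKernel N (s + t) (x - y) *
        gaussKernel N (s * t / (s + t)) (z - (s + t)⁻¹ • (t • x + s • y)) := by
  have hst : 0 < s + t := by positivity
  obtain ⟨a, ha⟩ : ∃ a, x - z = a := ⟨_, rfl⟩
  obtain ⟨b, hb⟩ : ∃ b, z - y = b := ⟨_, rfl⟩
  have h1 : x - y = a + b := by rw [← ha, ← hb]; abel
  have h2 : z - (s + t)⁻¹ • (t • x + s • y) = (s + t)⁻¹ • (s • b - t • a) := by
    have : z = (s + t)⁻¹ • ((s + t) • z) := by rw [smul_smul, inv_mul_cancel₀ hst.ne', one_smul]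
    nth_rewrite 1 [this]
    rw [← smul_sub, ← ha, ← hb]
    congr 1
    module
  rw [h1, h2, ha, hb]
  unfold gaussKernel
  simp only [mul_mul_mul_comm _ (Real.exp _)]
  rw [← Real.mul_rpow (by positivity) (by positivity),
    ← Real.mul_rpow (by positivity) (by positivity), ← Real.exp_add, ← Real.exp_add, norm_smul,
    mul_pow, norm_add_sq_real, norm_sub_sq_real, real_inner_smul_left, real_inner_smul_right,
    norm_smul, norm_smul, real_inner_comm, mul_pow, mul_pow]
  simp only [Real.norm_eq_abs, sq_abs]
  congr 2
  · field_simp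
  · field_simp
    ring

lemma lintegral_gaussKernel_mul_gaussKernel {s t : ℝ} (hs : 0 < s) (ht : 0 < t)
    (x y : EuclideanSpace ℝ (Fin N)) :
    ∫⁻ z, ENNReal.ofReal (gaussKernel N s (x - z)) * ENNReal.ofReal (gaussKernel N t (z - y)) =
      ENNReal.ofReal (gaussKernel N (s + t) (x - y)) := by
  have hst : 0 < s + t := by positivity
  simp_rw [← ENNReal.ofReal_mul (gaussKernel_pos hs _).le, gaussKernel_mul_gaussKernel hs ht,
    ENNReal.ofReal_mul (gaussKernel_pos hst _).le]
  rw [lintegral_const_mul' _ _ ENNReal.ofReal_ne_top, lintegral_sub_right_eq_self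
    (fun z => ENNReal.ofReal (gaussKernel N (s * t / (s + t)) z)),
    lintegral_gaussKernel (by positivity), mul_one]

lemma measurable_gaussKernel_sub (t : ℝ) :
    Measurable fun p : EuclideanSpace ℝ (Fin N) × EuclideanSpace ℝ (Fin N) =>
      ENNReal.ofReal (gaussKernel N t (p.1 - p.2)) :=
  (measurable_gaussKernel.comp (f := fun p : EuclideanSpace ℝ (Fin N) ×
    EuclideanSpace ℝ (Fin N) => (t, p.1 - p.2)) (by fun_prop)).ennreal_ofReal

lemma measurable_gaussKernel_const_sub (t : ℝ) (x : EuclideanSpace ℝ (Fin N)) :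
    Measurable fun y => ENNReal.ofReal (gaussKernel N t (x - y)) :=
  (measurable_gaussKernel.comp (f := fun y : EuclideanSpace ℝ (Fin N) => (t, x - y))
    (by fun_prop)).ennreal_ofReal

lemma heat_congr_ae {t : ℝ} {f g : EuclideanSpace ℝ (Fin N) → ℝ≥0∞} (h : f =ᵐ[volume] g)
    (x : EuclideanSpace ℝ (Fin N)) : heat t f x = heat t g x :=
  lintegral_congr_ae (h.mono fun y hy => by simp only [hy])

lemma heat_mono_ae {t : ℝ} {f g : EuclideanSpace ℝ (Fin N) → ℝ≥0∞} (h : f ≤ᵐ[volume] g)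
    (x : EuclideanSpace ℝ (Fin N)) : heat t f x ≤ heat t g x :=
  lintegral_mono_ae (h.mono fun y hy => by gcongr)

lemma heat_const_mul {t : ℝ} {c : ℝ≥0∞} (hc : c ≠ ∞) (f : EuclideanSpace ℝ (Fin N) → ℝ≥0∞)
    (x : EuclideanSpace ℝ (Fin N)) : heat t (fun y => c * f y) x = c * heat t f x := by
  unfold heat
  rw [← lintegral_const_mul' _ _ hc]
  exact lintegral_congr fun y => by ring

lemma heat_heat {s t : ℝ} (hs : 0 < s) (ht : 0 < t) {f : EuclideanSpace ℝ (Fin N) → ℝ≥0∞}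
    (hf : AEMeasurable f) (x : EuclideanSpace ℝ (Fin N)) :
    heat s (heat t f) x = heat (s + t) f x := by
  wlog hm : Measurable f generalizing f
  · have he : heat t f = heat t (hf.mk f) := funext fun z => heat_congr_ae hf.ae_eq_mk z
    rw [heat_congr_ae hf.ae_eq_mk, he]
    exact this hf.measurable_mk.aemeasurable hf.measurable_mk
  unfold heat
  simp_rw [← lintegral_const_mul' _ _ ENNReal.ofReal_ne_top]
  rw [lintegral_lintegral_swap]
  · refine lintegral_congr fun y => ?_
    rw [← lintegral_gaussKernel_mul_gaussKernel hs ht, ← lintegral_mul_const]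
    · exact lintegral_congr fun z => by ring
    · exact (measurable_gaussKernel_const_sub s x).mul
        (measurable_gaussKernel.comp (f := fun z : EuclideanSpace ℝ (Fin N) => (t, z - y))
          (by fun_prop)).ennreal_ofReal
  · have h1 : Measurable fun p : EuclideanSpace ℝ (Fin N) × EuclideanSpace ℝ (Fin N) =>
        ENNReal.ofReal (gaussKernel N s (x - p.1)) :=
      (measurable_gaussKernel_const_sub s x).comp measurable_fst
    have h2 : Measurable fun p : EuclideanSpace ℝ (Fin N) × EuclideanSpace ℝ (Fin N) =>
        f p.2 := hm.comp measurable_snd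
    exact (h1.mul ((measurable_gaussKernel_sub t).mul h2)).aemeasurable

lemma measurable_heat_sub {F : ℝ → EuclideanSpace ℝ (Fin N) → ℝ≥0∞}
    (hF : Measurable (Function.uncurry F)) (r : ℝ) :
    Measurable fun p : ℝ × EuclideanSpace ℝ (Fin N) => heat (r - p.1) (F p.1) p.2 := by
  unfold heat
  refine Measurable.lintegral_prod_right'
    (f := fun q : (ℝ × EuclideanSpace ℝ (Fin N)) × EuclideanSpace ℝ (Fin N) =>
      ENNReal.ofReal (gaussKernel N (r - q.1.1) (q.1.2 - q.2)) * F q.1.1 q.2) ?_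
  refine Measurable.mul (Measurable.ennreal_ofReal ?_) ?_
  · exact measurable_gaussKernel.comp
      (f := fun q : (ℝ × EuclideanSpace ℝ (Fin N)) × EuclideanSpace ℝ (Fin N) =>
        (r - q.1.1, q.1.2 - q.2)) (by fun_prop)
  · exact hF.comp
      (f := fun q : (ℝ × EuclideanSpace ℝ (Fin N)) × EuclideanSpace ℝ (Fin N) =>
        (q.1.1, q.2)) (by fun_prop)

/-- Tonelli and the semigroup law carry the Duhamel term from time s to time r; this is what makes
h(s) a primitive of a function independent of s. -/
lemma heat_lintegral {F : ℝ → EuclideanSpace ℝ (Fin N) → ℝ≥0∞}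
    (hF : Measurable (Function.uncurry F)) {r s : ℝ} (hrs : s < r)
    (x : EuclideanSpace ℝ (Fin N)) :
    heat (r - s) (fun z => ∫⁻ σ in Ioo 0 s, heat (s - σ) (F σ) z) x =
      ∫⁻ σ in Ioo 0 s, heat (r - σ) (F σ) x := by
  rw [heat]
  simp_rw [← lintegral_const_mul' _ _ ENNReal.ofReal_ne_top]
  rw [lintegral_lintegral_swap]
  · refine setLIntegral_congr_fun measurableSet_Ioo fun σ hσ => ?_
    change heat (r - s) (heat (s - σ) (F σ)) x = _
    rw [heat_heat (sub_pos.2 hrs) (sub_pos.2 hσ.2)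
      (f := F σ) (hF.comp (f := fun z => (σ, z)) measurable_prodMk_left).aemeasurable]
    congr 1
    ring
  · have h1 : Measurable fun p : EuclideanSpace ℝ (Fin N) × ℝ =>
        ENNReal.ofReal (gaussKernel N (r - s) (x - p.1)) :=
      (measurable_gaussKernel_const_sub (r - s) x).comp measurable_fst
    have h2 : Measurable fun p : EuclideanSpace ℝ (Fin N) × ℝ => heat (s - p.2) (F p.2) p.1 :=
      (measurable_heat_sub hF s).comp (f := fun p : EuclideanSpace ℝ (Fin N) × ℝ => (p.2, p.1))
        (by fun_prop)
    exact (h1.mul h2).aemeasurable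

/-! ### Jensen's inequality and the scalar integral inequality. -/

lemma lintegral_mul_rpow_le {X : Type*} [MeasurableSpace X] {ν : Measure X} {k f : X → ℝ≥0∞}
    (hk : Measurable k) (hk1 : ∫⁻ y, k y ∂ν = 1) (hf : Measurable f) {p : ℝ} (hp : 1 ≤ p) :
    (∫⁻ y, k y * f y ∂ν) ^ p ≤ ∫⁻ y, k y * f y ^ p ∂ν := by
  have : IsProbabilityMeasure (ν.withDensity k) := ⟨by simp [hk1]⟩
  have h := eLpNorm'_le_eLpNorm'_of_exponent_le one_pos hp (ν.withDensity k)
    hf.aestronglyMeasurable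
  simp only [eLpNorm'_eq_lintegral_enorm, enorm_eq_self, ENNReal.rpow_one, one_div,
    inv_one] at h
  rw [lintegral_withDensity_eq_lintegral_mul _ hk hf,
    lintegral_withDensity_eq_lintegral_mul _ hk (hf.pow_const p),
    ENNReal.le_rpow_inv_iff (by linarith)] at h
  exact h

lemma heat_rpow_le {t : ℝ} (ht : 0 < t) {p : ℝ} (hp : 1 ≤ p)
    {f : EuclideanSpace ℝ (Fin N) → ℝ≥0∞} (hf : Measurable f) (x : EuclideanSpace ℝ (Fin N)) :
    heat t f x ^ p ≤ heat t (fun y => f y ^ p) x := by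
  refine lintegral_mul_rpow_le (measurable_gaussKernel_const_sub t x) ?_ hf hp
  rw [lintegral_sub_left_eq_self (fun y => ENNReal.ofReal (gaussKernel N t y))]
  exact lintegral_gaussKernel ht

/-- The left side K of the integral inequality satisfies K' = G^{1+α} ≥ K^{1+α}, so K^{-α} + αs is
nonincreasing; compare its values at 0 and t. -/
lemma mul_rpow_le_one_of_integral_rpow_le {α g t : ℝ} (hα : 0 < α) (hg : 0 < g) (ht : 0 < t)
    {G : ℝ → ℝ} (hG : Continuous G) (hG0 : ∀ s ∈ Icc 0 t, 0 ≤ G s)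
    (hle : ∀ s ∈ Icc 0 t, g + ∫ σ in (0 : ℝ)..s, G σ ^ (1 + α) ≤ G s) :
    α * t * g ^ α ≤ 1 := by
  have hGp : Continuous fun s => G s ^ (1 + α) :=
    hG.rpow_const fun s => Or.inr (by linarith)
  set K : ℝ → ℝ := fun s => g + ∫ σ in (0 : ℝ)..s, G σ ^ (1 + α) with hK
  have hKd : ∀ s, HasDerivAt K (G s ^ (1 + α)) s := fun s =>
    (hGp.integral_hasStrictDerivAt 0 s).hasDerivAt.const_add g
  have hKg : ∀ s ∈ Icc 0 t, g ≤ K s := fun s hs => by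
    have : 0 ≤ ∫ σ in (0 : ℝ)..s, G σ ^ (1 + α) :=
      intervalIntegral.integral_nonneg hs.1 fun u hu =>
        Real.rpow_nonneg (hG0 u ⟨hu.1, hu.2.trans hs.2⟩) _
    simp only [hK]
    linarith
  have hd : ∀ s ∈ Icc 0 t, HasDerivAt (fun s => K s ^ (-α) + α * s)
      (G s ^ (1 + α) * (-α) * K s ^ (-α - 1) + α * 1) s := fun s hs =>
    ((hKd s).rpow_const (Or.inl (hg.trans_le (hKg s hs)).ne')).add
      ((hasDerivAt_id s).const_mul α)
  have hanti : AntitoneOn (fun s => K s ^ (-α) + α * s) (Icc 0 t) := by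
    refine antitoneOn_of_deriv_nonpos (convex_Icc 0 t)
      (fun s hs => (hd s hs).continuousAt.continuousWithinAt)
      (fun s hs => (hd s (interior_subset hs)).differentiableAt.differentiableWithinAt)
      fun s hs => ?_
    have hs' := interior_subset hs
    rw [(hd s hs').deriv]
    have hKpos := hg.trans_le (hKg s hs')
    have h1 : 1 ≤ G s ^ (1 + α) * K s ^ (-α - 1) := by
      calc (1 : ℝ) = K s ^ (1 + α) * K s ^ (-α - 1) := by
            rw [← Real.rpow_add hKpos]
            ring_nf
            simp
        _ ≤ _ := by
            gcongr
            exact hle s hs'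
    nlinarith
  have h := hanti (left_mem_Icc.2 ht.le) (right_mem_Icc.2 ht.le) ht.le
  have hK0 : K 0 = g := by simp [hK]
  simp only [hK0, mul_zero, add_zero] at h
  have hKt : 0 ≤ K t ^ (-α) :=
    Real.rpow_nonneg (hg.le.trans (hKg t (right_mem_Icc.2 ht.le))) _
  calc α * t * g ^ α ≤ g ^ (-α) * g ^ α := by gcongr; linarith
    _ = 1 := by rw [← Real.rpow_add hg]; simp

lemma ofReal_mul_rpow_le_one_of_lintegral_le {α t : ℝ} (hα : 0 < α) (ht : 0 < t) {g : ℝ≥0∞}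
    {h H : ℝ → ℝ≥0∞} (hH : Measurable H)
    (hle : ∀ᵐ s, s ∈ Ioo 0 t → g + ∫⁻ σ in Ioo 0 s, H σ ≤ h s)
    (hpow : ∀ s ∈ Ioo 0 t, h s ^ (1 + α) ≤ H s)
    (hfin : g + ∫⁻ σ in Ioo 0 t, H σ ≠ ∞) :
    ENNReal.ofReal (α * t) * g ^ α ≤ 1 := by
  obtain ⟨hgfin, hHfin⟩ := ENNReal.add_ne_top.1 hfin
  rcases eq_or_ne g 0 with rfl | hg0
  · simp [ENNReal.zero_rpow_of_pos hα]
  have hgpos : 0 < g.toReal := ENNReal.toReal_pos hg0 hgfin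
  set H' := (Ioo 0 t).indicator H with hH'
  have hH'm : Measurable H' := hH.indicator measurableSet_Ioo
  have hH'fin : ∫⁻ σ, H' σ ≠ ∞ := by rwa [lintegral_indicator measurableSet_Ioo]
  have hint : Integrable fun σ => (H' σ).toReal :=
    integrable_toReal_of_lintegral_ne_top hH'm.aemeasurable hH'fin
  have hH'lt : ∀ᵐ σ, H' σ < ∞ := ae_lt_top hH'm hH'fin
  -- The real lemma is applied to this primitive rather than to h: it is continuous and finite
  -- everywhere, and G^{1+α} ≤ h^{1+α} ≤ H a.e. on (0, t).
  set G : ℝ → ℝ := fun s => g.toReal + ∫ σ in (0 : ℝ)..s, (H' σ).toReal with hG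
  have hGc : Continuous G := continuous_const.add
    (intervalIntegral.continuous_primitive (fun a b => hint.intervalIntegrable) 0)
  have hG0 : ∀ s ∈ Icc 0 t, 0 ≤ G s := fun s hs => add_nonneg ENNReal.toReal_nonneg
    (intervalIntegral.integral_nonneg hs.1 fun _ _ => ENNReal.toReal_nonneg)
  have hGeq : ∀ s ∈ Icc 0 t, ENNReal.ofReal (G s) = g + ∫⁻ σ in Ioo 0 s, H σ := fun s hs => by
    have h1 : ∫ σ in (0 : ℝ)..s, (H' σ).toReal = (∫⁻ σ in Ioo 0 s, H σ).toReal := by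
      rw [intervalIntegral.integral_of_le hs.1, integral_toReal hH'm.aemeasurable
        (ae_restrict_of_ae hH'lt), ← restrict_Ioo_eq_restrict_Ioc]
      congr 1
      refine setLIntegral_congr_fun measurableSet_Ioo fun σ hσ => ?_
      exact indicator_of_mem (show σ ∈ Ioo 0 t from ⟨hσ.1, hσ.2.trans_le hs.2⟩) H
    have h2 : ∫⁻ σ in Ioo 0 s, H σ ≠ ∞ :=
      ne_top_of_le_ne_top hHfin (lintegral_mono_set (Ioo_subset_Ioo_right hs.2))
    simp only [hG]
    rw [h1, ENNReal.ofReal_add ENNReal.toReal_nonneg ENNReal.toReal_nonneg,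
      ENNReal.ofReal_toReal hgfin, ENNReal.ofReal_toReal h2]
  have hreal := mul_rpow_le_one_of_integral_rpow_le hα hgpos ht hGc hG0 fun s hs => by
    simp only [hG, add_le_add_iff_left]
    rw [intervalIntegral.integral_of_le hs.1, intervalIntegral.integral_of_le hs.1,
      ← restrict_Ioo_eq_restrict_Ioc]
    refine integral_mono_ae ?_ hint.integrableOn ?_
    · exact ((hGc.rpow_const fun s => Or.inr (by linarith)).continuousOn.integrableOn_Icc
        (a := 0) (b := s)).mono_set Ioo_subset_Icc_self
    · filter_upwards [ae_restrict_mem measurableSet_Ioo, ae_restrict_of_ae hle,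
        ae_restrict_of_ae hH'lt] with σ hσ h1 h2
      have hσt : σ ∈ Ioo 0 t := ⟨hσ.1, hσ.2.trans_le hs.2⟩
      have hσ' := Ioo_subset_Icc_self hσt
      rw [← ENNReal.ofReal_le_iff_le_toReal h2.ne,
        ← ENNReal.ofReal_rpow_of_nonneg (hG0 σ hσ') (by linarith), hGeq σ hσ', hH',
        indicator_of_mem hσt]
      exact (ENNReal.rpow_le_rpow (h1 hσt) (by linarith)).trans (hpow σ hσt)
  rw [← ENNReal.ofReal_toReal hgfin, ENNReal.ofReal_rpow_of_pos hgpos,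
    ← ENNReal.ofReal_mul (by positivity)]
  exact ENNReal.ofReal_le_one.2 hreal

/-! ### Necessary condition on the initial value. -/

lemma measurable_heat {t : ℝ} {f : EuclideanSpace ℝ (Fin N) → ℝ≥0∞} (hf : AEMeasurable f) :
    Measurable (heat t f) := by
  rw [show heat t f = heat t (hf.mk f) from funext fun z => heat_congr_ae hf.ae_eq_mk z]
  refine Measurable.lintegral_prod_right'
    (f := fun p : EuclideanSpace ℝ (Fin N) × EuclideanSpace ℝ (Fin N) =>
      ENNReal.ofReal (gaussKernel N t (p.1 - p.2)) * hf.mk f p.2) ?_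
  exact (measurable_gaussKernel_sub t).mul (hf.measurable_mk.comp measurable_snd)

lemma heat_add {t : ℝ} {f : EuclideanSpace ℝ (Fin N) → ℝ≥0∞} (hf : Measurable f)
    (g : EuclideanSpace ℝ (Fin N) → ℝ≥0∞) (x : EuclideanSpace ℝ (Fin N)) :
    heat t (fun y => f y + g y) x = heat t f x + heat t g x := by
  unfold heat
  simp_rw [mul_add]
  exact lintegral_add_left ((measurable_gaussKernel_const_sub t x).mul hf) _

lemma ofReal_abs_rpow_mul {α a : ℝ} (hα : 0 < α) (ha : 0 ≤ a) :
    ENNReal.ofReal (|a| ^ α * a) = ENNReal.ofReal a ^ (1 + α) := by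
  rw [ENNReal.ofReal_rpow_of_nonneg ha (by linarith), abs_of_nonneg ha, add_comm,
    Real.rpow_add_one' ha (by linarith)]

theorem IsNonnegSolution.ofReal_mul_heat_rpow_le_one {α T : ℝ} (hα : 0 < α)
    {u₀ : EuclideanSpace ℝ (Fin N) → ℝ} {u : ℝ → EuclideanSpace ℝ (Fin N) → ℝ}
    (hu : IsNonnegSolution α u₀ T u) (hu₀ : AEMeasurable fun y => ENNReal.ofReal (u₀ y)) :
    ∀ᵐ p : ℝ × EuclideanSpace ℝ (Fin N), p.1 ∈ Ioo 0 T →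
      ENNReal.ofReal (α * p.1) * heat p.1 (fun y => ENNReal.ofReal (u₀ y)) p.2 ^ α ≤ 1 := by
  set F : ℝ → EuclideanSpace ℝ (Fin N) → ℝ≥0∞ :=
    fun σ y => ENNReal.ofReal (|u σ y| ^ α * u σ y) with hF
  have hum : Measurable fun p : ℝ × EuclideanSpace ℝ (Fin N) => u p.1 p.2 := hu.measurable
  have hFm : Measurable (Function.uncurry F) := by
    change Measurable fun p : ℝ × EuclideanSpace ℝ (Fin N) =>
      ENNReal.ofReal (|u p.1 p.2| ^ α * u p.1 p.2)
    have habs : Measurable fun p : ℝ × EuclideanSpace ℝ (Fin N) => |u p.1 p.2| := hum.abs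
    exact ((habs.pow_const α).mul hum).ennreal_ofReal
  have hus : ∀ s, Measurable (u s) := fun s => hum.comp (f := fun z => (s, z))
    measurable_prodMk_left
  have heqn := hu.eqn
  rw [Measure.volume_eq_prod] at heqn
  have hslice := Measure.ae_ae_of_ae_prod heqn
  filter_upwards [hu.eqn] with p hp ht
  obtain ⟨t, x⟩ := p
  simp only at hp ht ⊢
  refine ofReal_mul_rpow_le_one_of_lintegral_le (t := t) hα ht.1
    (h := fun s => heat (t - s) (fun y => ENNReal.ofReal (u s y)) x)
    (H := fun σ => heat (t - σ) (F σ) x) ?_ ?_ ?_ ?_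
  · exact (measurable_heat_sub hFm t).comp (f := fun σ => (σ, x)) (by fun_prop)
  · filter_upwards [hslice] with s hs hst
    have h1 : (fun y => ENNReal.ofReal (u s y)) =ᵐ[volume] fun y =>
        heat s (fun y => ENNReal.ofReal (u₀ y)) y +
          ∫⁻ σ in Ioo 0 s, heat (s - σ) (F σ) y :=
      hs.mono fun y hy => hy ⟨hst.1, hst.2.trans ht.2⟩
    rw [heat_congr_ae h1, heat_add (measurable_heat hu₀),
      heat_heat (sub_pos.2 hst.2) hst.1 hu₀, heat_lintegral hFm hst.2, sub_add_cancel]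
  · intro s hs
    refine (heat_rpow_le (sub_pos.2 hs.2) (by linarith) (hus s).ennreal_ofReal x).trans_eq ?_
    simp only [hF, ofReal_abs_rpow_mul hα (hu.nonneg _ _)]
  -- The right side of the equation at (t, x) equals the finite number u(t, x).
  · rw [← hp ht]
    exact ENNReal.ofReal_ne_top

/-! ### Parabolic scaling and the truncated profile. -/

lemma gaussKernel_smul {c : ℝ} (hc : 0 < c) (z : EuclideanSpace ℝ (Fin N)) :
    gaussKernel N (c ^ 2) (c • z) = (c ^ N)⁻¹ * gaussKernel N 1 z := by
  unfold gaussKernel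
  rw [Real.mul_rpow (by positivity) (by positivity), norm_smul, mul_pow, Real.norm_eq_abs, sq_abs,
    ← Real.rpow_natCast c 2, ← Real.rpow_mul hc.le, mul_one]
  have h1 : c ^ (((2 : ℕ) : ℝ) * (-(N : ℝ) / 2)) = (c ^ N)⁻¹ := by
    rw [← Real.rpow_natCast c N, ← Real.rpow_neg hc.le]
    congr 1
    push_cast
    ring
  have h2 : -(c ^ ((2 : ℕ) : ℝ) * ‖z‖ ^ 2) / (4 * c ^ ((2 : ℕ) : ℝ)) = -‖z‖ ^ 2 / (4 * 1) := by
    field_simp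
  rw [h1, h2]
  ring

lemma lintegral_comp_smul_eq {c : ℝ} (hc : 0 < c) (f : EuclideanSpace ℝ (Fin N) → ℝ≥0∞) :
    ∫⁻ y, f y = ENNReal.ofReal (c ^ N) * ∫⁻ y, f (c • y) := by
  have h := Measure.map_addHaar_smul (volume : Measure (EuclideanSpace ℝ (Fin N))) hc.ne'
  have h2 := lintegral_map_equiv (μ := (volume : Measure (EuclideanSpace ℝ (Fin N)))) f
    (MeasurableEquiv.smul₀ c hc.ne')
  rw [MeasurableEquiv.coe_smul₀] at h2
  rw [h, lintegral_smul_measure, finrank_euclideanSpace_fin, abs_of_pos (by positivity)] at h2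
  rw [← h2, smul_eq_mul, ← mul_assoc, ← ENNReal.ofReal_mul (by positivity),
    mul_inv_cancel₀ (by positivity)]
  simp

lemma heat_sq_smul {c : ℝ} (hc : 0 < c) (f : EuclideanSpace ℝ (Fin N) → ℝ≥0∞)
    (x : EuclideanSpace ℝ (Fin N)) :
    heat (c ^ 2) f (c • x) = heat 1 (fun y => f (c • y)) x := by
  unfold heat
  rw [lintegral_comp_smul_eq hc, ← lintegral_const_mul' _ _ ENNReal.ofReal_ne_top]
  refine lintegral_congr fun y => ?_
  rw [← smul_sub, gaussKernel_smul hc, ← mul_assoc, ← ENNReal.ofReal_mul (by positivity),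
    ← mul_assoc, mul_inv_cancel₀ (by positivity), one_mul]

lemma ae_smul {c : ℝ} (hc : 0 < c) {p : EuclideanSpace ℝ (Fin N) → Prop} (h : ∀ᵐ x, p x) :
    ∀ᵐ x : EuclideanSpace ℝ (Fin N), p (c • x) := by
  have hq : Measure.QuasiMeasurePreserving (fun x : EuclideanSpace ℝ (Fin N) => c • x) := by
    refine ⟨measurable_const_smul c, ?_⟩
    rw [Measure.map_addHaar_smul _ hc.ne']
    exact Measure.smul_absolutelyContinuous
  exact hq.ae h

/-- The profile `ω |x|^{-γ}`, cut off to the closed ball of radius `R`. -/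
noncomputable def truncatedProfile (γ : ℝ) (ω : EuclideanSpace ℝ (Fin N) → ℝ) (R : ℝ)
    (y : EuclideanSpace ℝ (Fin N)) : ℝ≥0∞ :=
  (Metric.closedBall 0 R).indicator (fun y => ENNReal.ofReal (ω y * ‖y‖ ^ (-γ))) y

lemma truncatedProfile_mono (γ : ℝ) (ω : EuclideanSpace ℝ (Fin N) → ℝ) {R R' : ℝ}
    (h : R ≤ R') (y : EuclideanSpace ℝ (Fin N)) :
    truncatedProfile γ ω R y ≤ truncatedProfile γ ω R' y :=
  indicator_le_indicator_of_subset (Metric.closedBall_subset_closedBall h)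
    (fun _ => zero_le) y

lemma truncatedProfile_smul {γ c : ℝ} (hc : 0 < c) (R : ℝ) {ω : EuclideanSpace ℝ (Fin N) → ℝ}
    (hω : ∀ᵐ x, ω (c • x) = ω x) :
    (fun y => truncatedProfile γ ω R (c • y)) =ᵐ[volume]
      fun y => ENNReal.ofReal (c ^ (-γ)) * truncatedProfile γ ω (R / c) y := by
  filter_upwards [hω] with y hy
  unfold truncatedProfile
  have hmem : c • y ∈ Metric.closedBall (0 : EuclideanSpace ℝ (Fin N)) R ↔
      y ∈ Metric.closedBall (0 : EuclideanSpace ℝ (Fin N)) (R / c) := by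
    rw [mem_closedBall_zero_iff, mem_closedBall_zero_iff, norm_smul, Real.norm_of_nonneg hc.le,
      le_div_iff₀' hc]
  by_cases hmemy : y ∈ Metric.closedBall (0 : EuclideanSpace ℝ (Fin N)) (R / c)
  · rw [indicator_of_mem hmemy, indicator_of_mem (hmem.2 hmemy), hy,
      ← ENNReal.ofReal_mul (by positivity), norm_smul, Real.norm_of_nonneg hc.le,
      Real.mul_rpow hc.le (norm_nonneg y)]
    congr 1
    ring
  · rw [indicator_of_notMem hmemy, indicator_of_notMem (fun h => hmemy (hmem.1 h)), mul_zero]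

lemma heat_truncatedProfile_smul {γ c : ℝ} (hc : 0 < c) (R : ℝ)
    {ω : EuclideanSpace ℝ (Fin N) → ℝ} (hω : ∀ᵐ x, ω (c • x) = ω x)
    (x : EuclideanSpace ℝ (Fin N)) :
    heat (c ^ 2) (truncatedProfile γ ω R) (c • x) =
      ENNReal.ofReal (c ^ (-γ)) * heat 1 (truncatedProfile γ ω (R / c)) x := by
  rw [heat_sq_smul hc, heat_congr_ae (truncatedProfile_smul hc R hω),
    heat_const_mul ENNReal.ofReal_ne_top]

lemma aemeasurable_profile {γ : ℝ} {ω : EuclideanSpace ℝ (Fin N) → ℝ} (hω : AEMeasurable ω) :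
    AEMeasurable fun y : EuclideanSpace ℝ (Fin N) => ENNReal.ofReal (ω y * ‖y‖ ^ (-γ)) :=
  (hω.mul (by fun_prop)).ennreal_ofReal

lemma heat_profile_le_iSup {γ : ℝ} {ω : EuclideanSpace ℝ (Fin N) → ℝ} (hω : AEMeasurable ω)
    (t : ℝ) (x : EuclideanSpace ℝ (Fin N)) :
    heat t (fun y => ENNReal.ofReal (ω y * ‖y‖ ^ (-γ))) x ≤
      ⨆ n : ℕ, heat t (truncatedProfile γ ω (n + 1)) x := by
  unfold heat
  rw [← lintegral_iSup']
  · refine lintegral_mono fun y => ?_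
    obtain ⟨n, hn⟩ := exists_nat_ge ‖y‖
    refine le_iSup_of_le n ?_
    simp only [truncatedProfile]
    rw [indicator_of_mem]
    rw [mem_closedBall_zero_iff]
    linarith
  · intro n
    exact (measurable_gaussKernel_const_sub t x).aemeasurable.mul
      ((aemeasurable_profile hω).indicator measurableSet_closedBall)
  · refine ae_of_all _ fun y m n hmn => ?_
    dsimp only
    gcongr
    exact truncatedProfile_mono γ ω (by gcongr) y

/-- By monotone convergence in R: if every truncation stayed below M a.e., so would the full
profile. The sup norm is not assumed finite. -/
lemma exists_heat_truncatedProfile_gt {γ : ℝ} {ω : EuclideanSpace ℝ (Fin N) → ℝ}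
    (hω : AEMeasurable ω) {M : ℝ≥0∞}
    (hM : M < eLpNorm (heat 1 (fun x => ENNReal.ofReal (ω x * ‖x‖ ^ (-γ)))) ∞ volume) :
    ∃ R > 0, ¬ ∀ᵐ x, heat 1 (truncatedProfile γ ω R) x ≤ M := by
  by_contra! hc
  refine hM.not_ge ?_
  rw [eLpNorm_exponent_top]
  refine essSup_le_of_ae_le _ ?_
  have hall : ∀ᵐ x, ∀ n : ℕ, heat 1 (truncatedProfile γ ω (n + 1)) x ≤ M :=
    ae_all_iff.2 fun n => hc _ (by positivity)
  filter_upwards [hall] with x hx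
  exact (heat_profile_le_iSup hω 1 x).trans (iSup_le hx)

/-- The kernel is strictly positive, so vanishing at a single x already forces ω = 0 a.e.; `hN`
makes the origin a null set. -/
lemma eLpNorm_heat_profile_ne_zero (hN : 1 ≤ N) {γ : ℝ} {ω : EuclideanSpace ℝ (Fin N) → ℝ}
    (hω : AEMeasurable ω) (hω_nonneg : ∀ᵐ x, 0 ≤ ω x) (hω_ne : ¬ ∀ᵐ x, ω x = 0) :
    eLpNorm (heat 1 (fun x => ENNReal.ofReal (ω x * ‖x‖ ^ (-γ)))) ∞ volume ≠ 0 := by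
  intro h
  rw [eLpNorm_exponent_top] at h
  obtain ⟨x, hx⟩ := (ENNReal.essSup_eq_zero_iff.1 h).exists
  simp only [enorm_eq_self, Pi.zero_apply, heat] at hx
  replace hx := (lintegral_eq_zero_iff' ((measurable_gaussKernel_const_sub 1 x).aemeasurable.mul
    (aemeasurable_profile hω))).1 hx
  have : Nonempty (Fin N) := ⟨⟨0, hN⟩⟩
  have hne : ∀ᵐ y : EuclideanSpace ℝ (Fin N), y ≠ 0 := Measure.ae_ne volume 0
  refine hω_ne ?_
  filter_upwards [hx, hω_nonneg, hne] with y hy h0 hy0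
  have hpos : 0 < ‖y‖ ^ (-γ) := Real.rpow_pos_of_pos (norm_pos_iff.2 hy0) _
  have hk : ENNReal.ofReal (gaussKernel N 1 (x - y)) ≠ 0 := by
    simpa using gaussKernel_pos one_pos (x - y)
  have h1 : ω y * ‖y‖ ^ (-γ) ≤ 0 :=
    ENNReal.ofReal_eq_zero.1 ((mul_eq_zero.1 hy).resolve_left hk)
  exact le_antisymm (nonpos_of_mul_nonpos_left h1 hpos) h0

/-! ### Bound on the existence time. -/

lemma mul_rpow_le_one_of_ofReal {α γ l M t : ℝ} (hα : 0 < α) (hl : 0 < l) (hM : 0 < M)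
    (ht : 0 < t)
    (h : ENNReal.ofReal (α * t) *
      (ENNReal.ofReal l * (ENNReal.ofReal (√t ^ (-γ)) * ENNReal.ofReal M)) ^ α ≤ 1) :
    l * (α ^ (1 / α) * M) * t ^ (1 / α - γ / 2) ≤ 1 := by
  rw [← ENNReal.ofReal_mul (by positivity), ← ENNReal.ofReal_mul hl.le,
    ENNReal.ofReal_rpow_of_pos (by positivity), ← ENNReal.ofReal_mul (by positivity),
    ENNReal.ofReal_le_one] at h
  have h2 : ((α * t) * (l * (√t ^ (-γ) * M)) ^ α) ^ (1 / α) ≤ 1 :=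
    Real.rpow_le_one (by positivity) h (by positivity)
  rw [Real.mul_rpow (by positivity) (by positivity), Real.mul_rpow hα.le ht.le,
    ← Real.rpow_mul (by positivity), mul_one_div_cancel hα.ne', Real.rpow_one,
    Real.sqrt_eq_rpow, ← Real.rpow_mul ht.le] at h2
  rw [sub_eq_add_neg, Real.rpow_add ht, show -(γ / 2) = 1 / 2 * -γ by ring]
  refine le_of_eq_of_le ?_ h2
  ring

lemma exists_mem_Ioo_of_ae {p : ℝ → Prop} (h : ∀ᵐ t, p t) {a b : ℝ} (hab : a < b) :
    ∃ t ∈ Ioo a b, p t := by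
  by_contra! hc
  have h0 : volume (Ioo a b) = 0 := measure_mono_null hc h
  simp [Real.volume_Ioo] at h0
  linarith

theorem IsNonnegSolution.mul_rpow_le_one {α γ l ε T M R : ℝ} (hα : 0 < α) (hl : 0 < l)
    {ω φ : EuclideanSpace ℝ (Fin N) → ℝ}
    (hω_hom : ∀ τ : ℝ, 0 < τ → ∀ᵐ x, ω (τ • x) = ω x)
    (hφ : AEMeasurable φ) (hφω : ∀ᵐ x, ‖x‖ ≤ ε → ω x * ‖x‖ ^ (-γ) ≤ φ x)
    {u : ℝ → EuclideanSpace ℝ (Fin N) → ℝ} (hu : IsNonnegSolution α (fun x => l * φ x) T u)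
    (hM : 0 < M) (hR : 0 < R) (hε : 0 < ε)
    (hMR : ¬ ∀ᵐ x, heat 1 (truncatedProfile γ ω R) x ≤ ENNReal.ofReal M)
    {τ : ℝ} (hτ : 0 < τ) (hτT : τ < T) (hτR : τ < (ε / R) ^ 2) (hβ : 0 ≤ 1 / α - γ / 2) :
    l * (α ^ (1 / α) * M) * τ ^ (1 / α - γ / 2) ≤ 1 := by
  have hkey := hu.ofReal_mul_heat_rpow_le_one hα (hφ.const_mul l).ennreal_ofReal
  rw [Measure.volume_eq_prod] at hkey
  -- The necessary condition holds only for a.e. time, so a good t is taken just above τ; the final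
  -- bound at t implies the one at τ by monotonicity.
  obtain ⟨t, ⟨hτt, htm⟩, ht⟩ := exists_mem_Ioo_of_ae (Measure.ae_ae_of_ae_prod hkey)
    (lt_min hτT hτR)
  have ht0 : 0 < t := hτ.trans hτt
  have hc : 0 < √t := Real.sqrt_pos.2 ht0
  have hct : √t ^ 2 = t := Real.sq_sqrt ht0.le
  have hRt : R ≤ ε / √t := by
    have h1 : √t ≤ ε / R := Real.sqrt_le_iff.2 ⟨by positivity, (htm.trans_le (min_le_right _ _)).le⟩
    rw [le_div_iff₀ hR] at h1
    rw [le_div_iff₀ hc]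
    linarith
  -- The set where the truncated profile exceeds M is not null, so it meets the full-measure set
  -- where the condition holds at √t x.
  obtain ⟨x, hx, hxM⟩ : ∃ x, ENNReal.ofReal (α * t) *
      heat t (fun y => ENNReal.ofReal (l * φ y)) (√t • x) ^ α ≤ 1 ∧
      ENNReal.ofReal M < heat 1 (truncatedProfile γ ω R) x := by
    by_contra! hcon
    refine hMR ?_
    filter_upwards [ae_smul hc ht] with x hx
    exact hcon x (hx ⟨ht0, htm.trans_le (min_le_left _ _)⟩)
  have hprof : truncatedProfile γ ω ε ≤ᵐ[volume] fun y => ENNReal.ofReal (φ y) := by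
    filter_upwards [hφω] with y hy
    unfold truncatedProfile
    by_cases hyε : y ∈ Metric.closedBall (0 : EuclideanSpace ℝ (Fin N)) ε
    · rw [indicator_of_mem hyε]
      exact ENNReal.ofReal_le_ofReal (hy (mem_closedBall_zero_iff.1 hyε))
    · rw [indicator_of_notMem hyε]
      exact zero_le
  have hheat : ENNReal.ofReal l * (ENNReal.ofReal (√t ^ (-γ)) * ENNReal.ofReal M) ≤
      heat t (fun y => ENNReal.ofReal (l * φ y)) (√t • x) := by
    simp_rw [ENNReal.ofReal_mul hl.le]
    rw [heat_const_mul ENNReal.ofReal_ne_top]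
    gcongr
    calc ENNReal.ofReal (√t ^ (-γ)) * ENNReal.ofReal M
        ≤ ENNReal.ofReal (√t ^ (-γ)) * heat 1 (truncatedProfile γ ω (ε / √t)) x := by
          gcongr
          exact hxM.le.trans (heat_mono_ae (ae_of_all _ (truncatedProfile_mono γ ω hRt)) x)
      _ = heat t (truncatedProfile γ ω ε) (√t • x) := by
          rw [← heat_truncatedProfile_smul hc ε (hω_hom _ hc), hct]
      _ ≤ _ := heat_mono_ae hprof _
  have hfin : l * (α ^ (1 / α) * M) * t ^ (1 / α - γ / 2) ≤ 1 := by
    refine mul_rpow_le_one_of_ofReal hα hl hM ht0 (le_trans ?_ hx)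
    gcongr
  refine le_trans ?_ hfin
  gcongr

theorem eventually_Tmax_le {α γ ε : ℝ} (hα : 0 < α) (hβ : 0 < 1 / α - γ / 2)
    {ω φ : EuclideanSpace ℝ (Fin N) → ℝ} (hω : AEMeasurable ω)
    (hω_hom : ∀ τ : ℝ, 0 < τ → ∀ᵐ x, ω (τ • x) = ω x)
    (hφ : AEMeasurable φ) (hε : 0 < ε) (hφω : ∀ᵐ x, ‖x‖ ≤ ε → ω x * ‖x‖ ^ (-γ) ≤ φ x)
    {M : ℝ} (hM : 0 < M) (hMlt : ENNReal.ofReal M <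
      eLpNorm (heat 1 (fun x => ENNReal.ofReal (ω x * ‖x‖ ^ (-γ)))) ∞ volume) :
    ∀ᶠ l : ℝ in atTop, 0 < l ∧ Tmax α (fun x => l * φ x) ≤
      ENNReal.ofReal ((l * (α ^ (1 / α) * M)) ^ (-(1 / α - γ / 2)⁻¹)) := by
  obtain ⟨R, hR, hMR⟩ := exists_heat_truncatedProfile_gt hω hMlt
  set β := 1 / α - γ / 2 with hβdef
  set A := α ^ (1 / α) * M with hA
  have hApos : 0 < A := by positivity
  set t₀ := (ε / R) ^ 2 / 2 with ht₀
  have ht₀pos : 0 < t₀ := by positivity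
  have ht₀R : t₀ < (ε / R) ^ 2 := half_lt_self (by positivity)
  -- For such l the bound fails at t₀, so T ≤ t₀ and the restriction τ < (ε/R)² then holds for all τ
  -- < T.
  have hlarge : ∀ᶠ l : ℝ in atTop, 1 < l * (A * t₀ ^ β) :=
    (tendsto_id.atTop_mul_const (by positivity)).eventually_gt_atTop 1
  filter_upwards [hlarge, eventually_gt_atTop 0] with l hl hl0
  refine ⟨hl0, iSup₂_le fun T ⟨hT, u, hu⟩ => ENNReal.ofReal_le_ofReal ?_⟩
  have hbound : ∀ τ, 0 < τ → τ < T → τ < (ε / R) ^ 2 → l * A * τ ^ β ≤ 1 :=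
    fun τ h1 h2 h3 => hu.mul_rpow_le_one hα hl0 hω_hom hφ hφω hM hR hε hMR h1 h2 h3 hβ.le
  have hTt₀ : T ≤ t₀ := by
    by_contra! hlt
    have := hbound t₀ ht₀pos hlt ht₀R
    linarith
  refine le_of_forall_lt_imp_le_of_dense fun τ hτT => ?_
  rcases le_or_gt τ 0 with hτ | hτ
  · exact hτ.trans (by positivity)
  have h := hbound τ hτ hτT (hτT.trans_le (hTt₀.trans ht₀R.le))
  rw [Real.rpow_neg (by positivity), ← Real.inv_rpow (by positivity),
    Real.le_rpow_inv_iff_of_pos hτ.le (by positivity) hβ,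
    le_inv_comm₀ (by positivity) (by positivity), ← one_div, le_div_iff₀ (by positivity)]
  exact h

end NonlinearHeat

theorem theorem1p5 (N : ℕ) (hN : 1 ≤ N) (α γ : ℝ) (hα : 0 < α)
    (hγ : 0 < γ) (hγN : γ < N) (hγα : γ < 2 / α)
    (ω : EuclideanSpace ℝ (Fin N) → ℝ) (hω : MemLp ω ∞ volume)
    (hω_hom : ∀ τ : ℝ, 0 < τ → ∀ᵐ x, ω (τ • x) = ω x)
    (hω_nonneg : ∀ᵐ x, 0 ≤ ω x) (hω_ne : ¬ (∀ᵐ x, ω x = 0))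
    (φ : EuclideanSpace ℝ (Fin N) → ℝ) (hφ : LocallyIntegrable φ volume)
    (hφ_nonneg : ∀ᵐ x, 0 ≤ φ x)
    (ε : ℝ) (hε : 0 < ε) (hφω : ∀ᵐ x, ‖x‖ ≤ ε → ω x * ‖x‖ ^ (-γ) ≤ φ x) :
    (∀ᶠ l : ℝ in atTop, NonlinearHeat.Tmax α (fun x => l * φ x) < ∞) ∧
    limsup (fun l : ℝ => ENNReal.ofReal (l ^ (1 / α - γ / 2)⁻¹) *
        NonlinearHeat.Tmax α (fun x => l * φ x)) atTop ≤
      1 / (ENNReal.ofReal (α ^ (1 / α)) *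
        eLpNorm (NonlinearHeat.heat 1 (fun x => ENNReal.ofReal (ω x * ‖x‖ ^ (-γ)))) ∞ volume)
          ^ (1 / α - γ / 2)⁻¹ := by
  have hβ : 0 < 1 / α - γ / 2 := by
    have : 2 / α = 2 * (1 / α) := by ring
    linarith
  have hωm : AEMeasurable ω := hω.aestronglyMeasurable.aemeasurable
  have hφm : AEMeasurable φ := hφ.aestronglyMeasurable.aemeasurable
  have hS := NonlinearHeat.eLpNorm_heat_profile_ne_zero (γ := γ) hN hωm hω_nonneg hω_ne
  set S := eLpNorm (NonlinearHeat.heat 1 (fun x => ENNReal.ofReal (ω x * ‖x‖ ^ (-γ)))) ∞ volume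
  set β := 1 / α - γ / 2
  have key := fun (M : ℝ) (hM : 0 < M) (hMS : ENNReal.ofReal M < S) =>
    NonlinearHeat.eventually_Tmax_le hα hβ hωm hω_hom hφm hε hφω hM hMS
  have hβi : 0 < β⁻¹ := inv_pos.2 hβ
  have hαpos : 0 < α ^ (1 / α) := by positivity
  constructor
  · obtain ⟨q, hq0, hqS⟩ := ENNReal.lt_iff_exists_nnreal_btwn.1 (pos_iff_ne_zero.2 hS)
    have hq0' : 0 < (q : ℝ) := by exact_mod_cast hq0
    filter_upwards [key q hq0' (by rwa [ENNReal.ofReal_coe_nnreal])] with l hl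
    exact hl.2.trans_lt ENNReal.ofReal_lt_top
  -- Isolating S reduces the claim to every c < S, for which the algebra is undone; this also covers
  -- S = ∞.
  · rw [one_div, ENNReal.le_inv_iff_le_inv, ← ENNReal.le_rpow_inv_iff hβi, mul_comm,
      ← ENNReal.le_div_iff_mul_le (Or.inl (by simpa using hαpos))
        (Or.inl ENNReal.ofReal_ne_top)]
    refine le_of_forall_lt_imp_le_of_dense fun c hc => ?_
    rcases eq_or_ne c 0 with rfl | hc0
    · exact zero_le
    have hctop : c ≠ ∞ := (hc.trans_le le_top).ne
    have hM : 0 < c.toReal := ENNReal.toReal_pos hc0 hctop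
    rw [ENNReal.le_div_iff_mul_le (Or.inl (by simpa using hαpos))
        (Or.inl ENNReal.ofReal_ne_top), mul_comm, ENNReal.le_rpow_inv_iff hβi,
      ENNReal.le_inv_iff_le_inv, ← ENNReal.rpow_neg]
    refine limsup_le_of_le (by isBoundedDefault) ?_
    filter_upwards [key c.toReal hM (by rwa [ENNReal.ofReal_toReal hctop])] with l hl
    obtain ⟨hl0, hl⟩ := hl
    refine (mul_le_mul_right hl _).trans_eq ?_
    -- The powers of l cancel exactly, leaving a bound independent of l.
    rw [← ENNReal.ofReal_mul (by positivity), Real.mul_rpow hl0.le (by positivity), ← mul_assoc,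
      ← Real.rpow_add hl0, add_neg_cancel, Real.rpow_zero, one_mul,
      ← ENNReal.ofReal_rpow_of_pos (by positivity), ENNReal.ofReal_mul hαpos.le,
      ENNReal.ofReal_toReal hctop]
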